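/- Let $\mu\in(-1,1)$ and $x_0,x_1\in[-\tfrac13,1]$, and put $a=x_0+x_1$, $d=x_0-x_1$. For $i\in\{0,1\}$ let $\Lambda_i(\rho)=x_i\,\rho+(1-x_i)\,\mathrm{Tr}(\rho)\,\tfrac{1}{2}I$ be the qubit depolarizing channel with parameter $x_i$, let $E_{00}=E_{11}=\frac{1+\mu}{2}$, $E_{01}=E_{10}=\frac{1-\mu}{2}$ be the transition matrix of the switching Markov chain, started in its stationary distribution $(\tfrac12,\tfrac12)$, and let $$\Gamma_2^{\mu,a,d}=\sum_{i,j\in\{0,1\}}\tfrac12\,E_{ij}\,\Lambda_i\otimes\Lambda_j$$ be the resulting two-use (two-qubit) memory channel. For a finite ensemble $\{p_k,\rho_k\}$ of two-qubit density matrices write $$\chi(\{p_k,\rho_k\})=S\Big(\sum_k p_k\,\Gamma_2^{\mu,a,d}(\rho_k)\Big)-\sum_k p_k\,S\big(\Gamma_2^{\mu,a,d}(\rho_k)\big),\qquad S(\rho)=-\mathrm{Tr}(\rho\log_2\rho),$$ and let $C_2(\Gamma_2^{\mu,a,d})=\tfrac12\max_{\{p_k,\rho_k\}}\chi(\{p_k,\rho_k\})$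 be the two-qubit capacity (in bits per channel use). Put $$f=|a^2+\mu d^2|-2|a|,$$ $$\lambda_{00}=\tfrac{1+\mu}{4}\Big[\tfrac{(1+x_0)^2}{4}+\tfrac{(1+x_1)^2}{4}\Big]+\tfrac{1-\mu}{4}\cdot\tfrac{2(1+x_0)(1+x_1)}{4},$$ $$\lambda_{01}=\tfrac{1+\mu}{4}\Big[\tfrac{1-x_0^2}{4}+\tfrac{1-x_1^2}{4}\Big]+\tfrac{1-\mu}{4}\Big[\tfrac{(1+x_0)(1-x_1)}{4}+\tfrac{(1-x_0)(1+x_1)}{4}\Big],$$ $$\lambda_{11}=\tfrac{1+\mu}{4}\Big[\tfrac{(1-x_0)^2}{4}+\tfrac{(1-x_1)^2}{4}\Big]+\tfrac{1-\mu}{4}\cdot\tfrac{2(1-x_0)(1-x_1)}{4}.$$ Then, with the convention $0\log_2 0=0$: 1. If $f\ge 0$, the maximum defining $C_2$ is attained by an ensemble of maximally entangled pure states; indeed, for every maximally entangled unit vector $\psi$ it is attained by the ensemble of the sixteen equiprobable states $(\sigma_i\otimes\sigma_j)|\psi\rangle\langle\psi|(\sigma_i\otimes\sigma_j)$, where $\sigma_0=I$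 and $\sigma_1,\sigma_2,\sigma_3$ are the Pauli matrices. Moreover $$C_2(\Gamma_2^{\mu,a,d})=1+\tfrac12\big[(1-3\lambda_{01})\log_2(1-3\lambda_{01})+3\lambda_{01}\log_2\lambda_{01}\big].$$ 2. If $f\le 0$ (in particular whenever $f<0$), the maximum is attained by an ensemble of pure product states; indeed, for every product unit vector $\psi$ it is attained by the same equiprobable ensemble of sixteen states built from $\psi$. Moreover $$C_2(\Gamma_2^{\mu,a,d})=1+\tfrac12\big[\lambda_{00}\log_2\lambda_{00}+2\lambda_{01}\log_2\lambda_{01}+\lambda_{11}\log_2\lambda_{11}\big].$$ -/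

import Mathlib

open scoped Kronecker Matrix ComplexOrder

noncomputable section

namespace QMemory

/-- Density matrices: positive semidefinite with unit trace. -/
def IsDensity {n : Type} [Fintype n] (ρ : Matrix n n ℂ) : Prop :=
  ρ.PosSemidef ∧ ρ.trace = 1

/-- Unit vectors for the Euclidean (Hilbert space) norm. -/
def IsUnitVec {n : Type} [Fintype n] (ψ : n → ℂ) : Prop :=
  star ψ ⬝ᵥ ψ = 1

/-- The rank-one operator `|ψ⟩⟨ψ|`. -/
def proj {n : Type} (ψ : n → ℂ) : Matrix n n ℂ :=
  Matrix.vecMulVec ψ (star ψ)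

open Classical in
/-- Von Neumann entropy `-Tr (ρ log₂ ρ)` of a Hermitian matrix, in bits, with `0 log 0 = 0`. -/
def entropy {n : Type} [Fintype n] (ρ : Matrix n n ℂ) : ℝ :=
  if h : ρ.IsHermitian then ∑ i, Real.negMulLog (h.eigenvalues i) / Real.log 2 else 0

/-- Finite ensembles `{p_i, ρ_i}` of (pure or mixed) states. -/
structure Ensemble (n : Type) [Fintype n] where
  ι : Type
  [fintype_ι : Fintype ι]
  prob : ι → ℝ
  state : ι → Matrix n n ℂ
  prob_nonneg : ∀ i, 0 ≤ prob i
  prob_sum : ∑ i, prob i = 1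
  isDensity : ∀ i, IsDensity (state i)

attribute [instance] Ensemble.fintype_ι

/-- Holevo quantity `S(∑ p_i Φ(ρ_i)) - ∑ p_i S(Φ(ρ_i))` of an ensemble sent through `Φ`. -/
def holevo {n m : Type} [Fintype n] [Fintype m]
    (Φ : Matrix n n ℂ →ₗ[ℂ] Matrix m m ℂ) (𝓔 : Ensemble n) : ℝ :=
  entropy (∑ i, (𝓔.prob i : ℂ) • Φ (𝓔.state i)) - ∑ i, 𝓔.prob i * entropy (Φ (𝓔.state i))

/-- The Holevo capacity `χ*(Φ)`: supremum of the Holevo quantity over all ensembles. -/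
def holevoCapacity {n m : Type} [Fintype n] [Fintype m]
    (Φ : Matrix n n ℂ →ₗ[ℂ] Matrix m m ℂ) : ℝ :=
  sSup (Set.range (holevo Φ))

/-- The ensemble `𝓔` attains the maximum of the Holevo quantity over all ensembles. -/
def IsOptimal {n m : Type} [Fintype n] [Fintype m]
    (Φ : Matrix n n ℂ →ₗ[ℂ] Matrix m m ℂ) (𝓔 : Ensemble n) : Prop :=
  IsGreatest (Set.range (holevo Φ)) (holevo Φ 𝓔)

/-- Qubit depolarizing channel `ρ ↦ x ρ + (1 - x) 1/2`, extended linearly from trace-one `ρ`. -/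
def depolarizing (x : ℝ) : Matrix (Fin 2) (Fin 2) ℂ →ₗ[ℂ] Matrix (Fin 2) (Fin 2) ℂ :=
  (x : ℂ) • LinearMap.id +
    (Matrix.traceLinearMap (Fin 2) ℂ ℂ).smulRight ((((1 - x) / 2 : ℝ) : ℂ) • 1)

/-- Tensor product of two linear maps on matrices. -/
def tensorMap {m n : Type} [Fintype m] [Fintype n] [DecidableEq m] [DecidableEq n]
    (Φ : Matrix m m ℂ →ₗ[ℂ] Matrix m m ℂ) (Ψ : Matrix n n ℂ →ₗ[ℂ] Matrix n n ℂ) :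
    Matrix (m × n) (m × n) ℂ →ₗ[ℂ] Matrix (m × n) (m × n) ℂ :=
  ∑ i, ∑ j, ∑ k, ∑ l, (Matrix.entryLinearMap ℂ ℂ (i, k) (j, l)).smulRight
    (Φ (Matrix.single i j 1) ⊗ₖ Ψ (Matrix.single k l 1))

/-- `tensorMap Φ Ψ` is the linear map determined by `A ⊗ B ↦ Φ A ⊗ Ψ B`. -/
theorem tensorMap_kronecker {m n : Type} [Fintype m] [Fintype n] [DecidableEq m] [DecidableEq n]
    (Φ : Matrix m m ℂ →ₗ[ℂ] Matrix m m ℂ) (Ψ : Matrix n n ℂ →ₗ[ℂ] Matrix n n ℂ)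
    (A : Matrix m m ℂ) (B : Matrix n n ℂ) :
    tensorMap Φ Ψ (A ⊗ₖ B) = Φ A ⊗ₖ Ψ B := by
  have hA : Φ A = ∑ i, ∑ j, A i j • Φ (Matrix.single i j 1) := by
    conv_lhs => rw [Matrix.matrix_eq_sum_single A]
    simp only [map_sum, ← map_smul, Matrix.smul_single, smul_eq_mul, mul_one]
  have hB : Ψ B = ∑ i, ∑ j, B i j • Ψ (Matrix.single i j 1) := by
    conv_lhs => rw [Matrix.matrix_eq_sum_single B]
    simp only [map_sum, ← map_smul, Matrix.smul_single, smul_eq_mul, mul_one]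
  rw [hA, hB]
  ext ⟨a, b⟩ ⟨c, d⟩
  simp only [tensorMap, LinearMap.sum_apply, LinearMap.smulRight_apply, Matrix.sum_apply,
    Matrix.smul_apply, Matrix.kroneckerMap_apply, Matrix.entryLinearMap_apply, smul_eq_mul]
  simp only [Finset.sum_mul]
  simp only [Finset.mul_sum]
  refine Finset.sum_congr rfl fun i _ => Finset.sum_congr rfl fun j _ =>
    Finset.sum_congr rfl fun k _ => Finset.sum_congr rfl fun l _ => by ring

/-- Two uses of the memory channel that applies `depolarizing (x i)` when the Markov chain is in
state `i`: the chain has initial distribution `γ` and transition matrix `E`. -/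
def memoryChannel (γ : Fin 2 → ℝ) (E : Matrix (Fin 2) (Fin 2) ℝ) (x : Fin 2 → ℝ) :
    Matrix (Fin 2 × Fin 2) (Fin 2 × Fin 2) ℂ →ₗ[ℂ] Matrix (Fin 2 × Fin 2) (Fin 2 × Fin 2) ℂ :=
  ∑ i, ∑ j, ((γ i * E i j : ℝ) : ℂ) • tensorMap (depolarizing (x i)) (depolarizing (x j))

/-- The symmetric transition matrix with memory `μ`. -/
def transition (μ : ℝ) : Matrix (Fin 2) (Fin 2) ℝ :=
  !![(1 + μ) / 2, (1 - μ) / 2; (1 - μ) / 2, (1 + μ) / 2]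

/-- The stationary distribution of `transition μ`. -/
def stationary : Fin 2 → ℝ := fun _ => 1 / 2

theorem stationary_vecMul_transition (μ : ℝ) : stationary ᵥ* transition μ = stationary := by
  ext i
  fin_cases i <;> simp [Matrix.vecMul, dotProduct, stationary, transition] <;> ring

/-- The two-qubit channel `Γ₂^{μ,a,d}`, in terms of `x₀`, `x₁`. -/
def channel (μ x₀ x₁ : ℝ) :
    Matrix (Fin 2 × Fin 2) (Fin 2 × Fin 2) ℂ →ₗ[ℂ] Matrix (Fin 2 × Fin 2) (Fin 2 × Fin 2) ℂ :=
  memoryChannel stationary (transition μ) ![x₀, x₁]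

/-- The two-use capacity `C₂ = χ*(Γ₂) / 2`. -/
def twoUseCapacity (μ x₀ x₁ : ℝ) : ℝ := holevoCapacity (channel μ x₀ x₁) / 2

/-- The Pauli matrices `σ₀ = 1`, `σ₁`, `σ₂`, `σ₃`. -/
def pauli : Fin 4 → Matrix (Fin 2) (Fin 2) ℂ :=
  ![!![1, 0; 0, 1], !![0, 1; 1, 0], !![0, -Complex.I; Complex.I, 0], !![1, 0; 0, -1]]

/-- `|ψ⟩ = |u⟩ ⊗ |v⟩` with unit vectors `u`, `v`. -/
def IsProductVec (ψ : Fin 2 × Fin 2 → ℂ) : Prop :=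
  ∃ u v : Fin 2 → ℂ, IsUnitVec u ∧ IsUnitVec v ∧ ∀ i j, ψ (i, j) = u i * v j

/-- Maximally entangled: the reduced state of each qubit is the completely mixed state `1/2`. -/
def IsMaxEntangledVec (ψ : Fin 2 × Fin 2 → ℂ) : Prop :=
  (∀ i i', ∑ j, ψ (i, j) * star (ψ (i', j)) = if i = i' then 1 / 2 else 0) ∧
    ∀ j j', ∑ i, ψ (i, j) * star (ψ (i, j')) = if j = j' then 1 / 2 else 0

theorem pauli_conjTranspose_mul (i : Fin 4) : (pauli i)ᴴ * pauli i = 1 := by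
  fin_cases i <;> ext a b <;> fin_cases a <;> fin_cases b <;>
    simp [pauli, Matrix.mul_apply, Matrix.conjTranspose_apply]

theorem IsUnitVec.pauli_mulVec {ψ : Fin 2 × Fin 2 → ℂ} (hψ : IsUnitVec ψ) (i j : Fin 4) :
    IsUnitVec ((pauli i ⊗ₖ pauli j) *ᵥ ψ) := by
  have h : (pauli i ⊗ₖ pauli j)ᴴ * (pauli i ⊗ₖ pauli j) = 1 := by
    rw [Matrix.conjTranspose_kronecker, ← Matrix.mul_kronecker_mul, pauli_conjTranspose_mul,
      pauli_conjTranspose_mul, Matrix.one_kronecker_one]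
  unfold IsUnitVec at *
  rw [Matrix.star_mulVec, Matrix.dotProduct_mulVec, Matrix.vecMul_vecMul, h, Matrix.vecMul_one, hψ]

theorem IsUnitVec.isDensity_proj {n : Type} [Fintype n] {ψ : n → ℂ} (hψ : IsUnitVec ψ) :
    IsDensity (proj ψ) := by
  refine ⟨Matrix.posSemidef_vecMulVec_self_star ψ, ?_⟩
  rw [proj, Matrix.trace_vecMulVec, dotProduct_comm]
  exact hψ

/-- The ensemble of the sixteen equiprobable states `(σ_i ⊗ σ_j) |ψ⟩⟨ψ| (σ_i ⊗ σ_j)`. -/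
def pauliEnsemble (ψ : Fin 2 × Fin 2 → ℂ) (hψ : IsUnitVec ψ) : Ensemble (Fin 2 × Fin 2) where
  ι := Fin 4 × Fin 4
  prob := fun _ => 1 / 16
  state := fun k => proj ((pauli k.1 ⊗ₖ pauli k.2) *ᵥ ψ)
  prob_nonneg := fun _ => by norm_num
  prob_sum := by simp
  isDensity := fun k => (hψ.pauli_mulVec k.1 k.2).isDensity_proj

/-- The threshold function `f = |a² + μ d²| - 2|a|`. -/
def threshold (μ a d : ℝ) : ℝ := |a ^ 2 + μ * d ^ 2| - 2 * |a|

/-- `λ₀₀`. -/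
def eig00 (μ x₀ x₁ : ℝ) : ℝ :=
  (1 + μ) / 4 * ((1 + x₀) * (1 + x₀) / 4 + (1 + x₁) * (1 + x₁) / 4) +
    (1 - μ) / 4 * (2 * (1 + x₀) * (1 + x₁) / 4)

/-- `λ₀₁ = λ₁₀`. -/
def eig01 (μ x₀ x₁ : ℝ) : ℝ :=
  (1 + μ) / 4 * ((1 + x₀) * (1 - x₀) / 4 + (1 + x₁) * (1 - x₁) / 4) +
    (1 - μ) / 4 * ((1 + x₀) * (1 - x₁) / 4 + (1 - x₀) * (1 + x₁) / 4)

/-- `λ₁₁`. -/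
def eig11 (μ x₀ x₁ : ℝ) : ℝ :=
  (1 + μ) / 4 * ((1 - x₀) * (1 - x₀) / 4 + (1 - x₁) * (1 - x₁) / 4) +
    (1 - μ) / 4 * (2 * (1 - x₀) * (1 - x₁) / 4)

end QMemory

end

open QMemory

/-!
Write `α = a / 2` and `β = (a² + μ d²) / 4`. In the Pauli basis the channel fixes the identity,
multiplies the local Bloch components `σ_i ⊗ 1`, `1 ⊗ σ_i` by `α`, and the correlations `σ_i ⊗ σ_j` by
`β`. The spin flip `ψ̃ = (σ₂ ⊗ σ₂) ψ̄` reverses both Bloch vectors and keeps the correlations, so that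
on a pure state the channel acts by
`|ψ⟩⟨ψ| ↦ (1 - β) / 4 + (β + α) / 2 |ψ⟩⟨ψ| + (β - α) / 2 |ψ̃⟩⟨ψ̃|` (`channel_proj`).

The output is thus a rank-two perturbation of a scalar. Its eigenvalues are `(1 - β) / 4`, twice, and
`(1 + β) / 4 ± k` with `(2 k)² = α² (1 - C²) + β² C²`, where `C = |⟨ψ̃|ψ⟩|` is the concurrence of `ψ`
(`charpoly_roots_channel_proj`). The entropy decreases in `k` (`outputEntropy_anti`), and `(2 k)²`
interpolates between `α²` at `C = 0`, the product vectors, and `β²` at `C = 1`, the maximally entangled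
vectors. As `f = 4 (|β| - |α|)`, the sign of `f` tells which of them have the least output entropy;
concavity of the entropy (`le_entropy_sum`) extends the lower bound to mixed inputs.

No output has entropy above `2`, so the Holevo quantity is at most `2` minus the least output entropy
(`holevo_le`). The Pauli orbit of an optimal `ψ` attains this: Pauli matrices do not change `C`, and the
orbit averages to the completely mixed state, which the unital channel preserves.
-/

namespace QMemory

/-! ### Entropy of Hermitian matrices -/

lemma isHermitian_proj {n : Type} [Fintype n] (ψ : n → ℂ) : (proj ψ).IsHermitian :=
  (Matrix.posSemidef_vecMulVec_self_star ψ).1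

section Entropy

variable {n : Type} [Fintype n] [DecidableEq n]

lemma entropy_eq_sum_eigenvalues {A : Matrix n n ℂ} (hA : A.IsHermitian) :
    entropy A = (∑ i, Real.negMulLog (hA.eigenvalues i)) / Real.log 2 := by
  rw [entropy, dif_pos hA, Finset.sum_div]
  congr!

lemma entropy_eq_roots {A : Matrix n n ℂ} (hA : A.IsHermitian) :
    entropy A =
      (A.charpoly.roots.map fun z : ℂ => Real.negMulLog z.re).sum / Real.log 2 := by
  rw [entropy_eq_sum_eigenvalues hA, hA.roots_charpoly_eq_eigenvalues, Multiset.map_map]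
  rfl

lemma posSemidef_of_roots {A : Matrix n n ℂ} (hA : A.IsHermitian)
    (h : ∀ z ∈ A.charpoly.roots, 0 ≤ z.re) : A.PosSemidef := by
  rw [hA.posSemidef_iff_eigenvalues_nonneg]
  intro i
  have := h (hA.eigenvalues i : ℂ) (by
    rw [hA.roots_charpoly_eq_eigenvalues]
    exact Multiset.mem_map_of_mem _ (Finset.mem_univ i))
  simpa using this

lemma conj_eigenvectorUnitary {A : Matrix n n ℂ} (hA : A.IsHermitian) :
    (hA.eigenvectorUnitary : Matrix n n ℂ)ᴴ * A * (hA.eigenvectorUnitary : Matrix n n ℂ) =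
      Matrix.diagonal fun i => (hA.eigenvalues i : ℂ) := by
  have h := hA.conjStarAlgAut_star_eigenvectorUnitary
  rw [Unitary.conjStarAlgAut_star_apply] at h
  exact h

lemma IsDensity.sum_eigenvalues {ρ : Matrix n n ℂ} (h : IsDensity ρ) :
    ∑ i, h.1.1.eigenvalues i = 1 := by
  have := h.1.1.trace_eq_sum_eigenvalues.symm.trans h.2
  exact Complex.ofReal_injective (by simpa using this)

/-- A density matrix is a convex combination of pure states. -/
lemma IsDensity.exists_eq_sum_proj {ρ : Matrix n n ℂ} (h : IsDensity ρ) :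
    ∃ (p : n → ℝ) (ψ : n → n → ℂ), (∀ i, 0 ≤ p i) ∧ ∑ i, p i = 1 ∧ (∀ i, IsUnitVec (ψ i)) ∧
      ρ = ∑ i, (p i : ℂ) • proj (ψ i) := by
  have hH := h.1.1
  set U : Matrix n n ℂ := hH.eigenvectorUnitary.val with hU
  have hUU : Uᴴ * U = 1 := Unitary.coe_star_mul_self hH.eigenvectorUnitary
  have hUU' : U * Uᴴ = 1 := Unitary.coe_mul_star_self hH.eigenvectorUnitary
  refine ⟨hH.eigenvalues, fun i j => U j i, h.1.eigenvalues_nonneg, h.sum_eigenvalues,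
    fun i => ?_, ?_⟩
  · have := congrFun (congrFun hUU i) i
    simpa [Matrix.mul_apply, IsUnitVec, dotProduct] using this
  · have h1 : ρ = U * (Uᴴ * ρ * U) * Uᴴ := by
      calc ρ = (U * Uᴴ) * ρ * (U * Uᴴ) := by simp [hUU']
        _ = _ := by simp only [Matrix.mul_assoc]
    rw [hU, conj_eigenvectorUnitary hH, ← hU] at h1
    refine h1.trans ?_
    ext a b
    rw [Matrix.mul_apply, Matrix.sum_apply]
    refine Finset.sum_congr rfl fun i _ => ?_
    rw [Matrix.mul_diagonal]
    simp only [Matrix.smul_apply, proj, Matrix.vecMulVec_apply, Matrix.conjTranspose_apply,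
      Pi.star_apply, smul_eq_mul]
    ring

lemma sum_normSq_row {W : Matrix n n ℂ} (h : W * Wᴴ = 1) (i : n) :
    ∑ j, Complex.normSq (W i j) = 1 := by
  have := congrFun (congrFun h i) i
  simp only [Matrix.mul_apply, Matrix.conjTranspose_apply, Matrix.one_apply_eq] at this
  have h2 : ((∑ j, Complex.normSq (W i j) : ℝ) : ℂ) = 1 := by
    rw [← this]; push_cast
    exact Finset.sum_congr rfl fun j _ => (Complex.mul_conj _).symm
  exact_mod_cast h2

/-- Peierls' inequality: pinching a positive semidefinite matrix to the diagonal of any orthonormal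
basis does not decrease the entropy. -/
lemma sum_negMulLog_eigenvalues_le {A : Matrix n n ℂ} (hA : A.PosSemidef)
    {V : Matrix n n ℂ} (hV : Vᴴ * V = 1) :
    ∑ i, Real.negMulLog (hA.1.eigenvalues i) ≤
      ∑ i, Real.negMulLog ((Vᴴ * A * V) i i).re := by
  set U : Matrix n n ℂ := hA.1.eigenvectorUnitary.val with hU
  have hUU : Uᴴ * U = 1 := Unitary.coe_star_mul_self hA.1.eigenvectorUnitary
  have hUU' : U * Uᴴ = 1 := Unitary.coe_mul_star_self hA.1.eigenvectorUnitary
  have hV' : V * Vᴴ = 1 := mul_eq_one_comm.mp hV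
  set W := Vᴴ * U with hW
  have hWc : Wᴴ = Uᴴ * V := by simp [hW, Matrix.conjTranspose_mul]
  have hW1 : W * Wᴴ = 1 := by
    calc W * Wᴴ = Vᴴ * (U * Uᴴ) * V := by rw [hWc, hW]; simp only [Matrix.mul_assoc]
      _ = 1 := by simp [hUU', hV]
  have hW2 : Wᴴ * Wᴴᴴ = 1 := by
    rw [Matrix.conjTranspose_conjTranspose]; exact mul_eq_one_comm.mp hW1
  have hdiag : Vᴴ * A * V =
      W * (Matrix.diagonal fun i => (hA.1.eigenvalues i : ℂ)) * Wᴴ := by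
    rw [← conj_eigenvectorUnitary hA.1, ← hU, hWc, hW]
    calc Vᴴ * A * V = Vᴴ * (U * Uᴴ) * A * (U * Uᴴ) * V := by simp [hUU']
      _ = _ := by simp only [Matrix.mul_assoc]
  have hentry : ∀ i, ((Vᴴ * A * V) i i).re =
      ∑ j, Complex.normSq (W i j) * hA.1.eigenvalues j := by
    intro i
    rw [hdiag, Matrix.mul_apply, Complex.re_sum]
    refine Finset.sum_congr rfl fun j _ => ?_
    rw [Matrix.mul_diagonal, Matrix.conjTranspose_apply, mul_right_comm]
    have : W i j * star (W i j) = (Complex.normSq (W i j) : ℂ) := Complex.mul_conj _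
    rw [this, ← Complex.ofReal_mul, Complex.ofReal_re]
  calc ∑ j, Real.negMulLog (hA.1.eigenvalues j)
      = ∑ j, ∑ i, Complex.normSq (W i j) * Real.negMulLog (hA.1.eigenvalues j) := by
        refine Finset.sum_congr rfl fun j _ => ?_
        have := sum_normSq_row hW2 j
        simp only [Matrix.conjTranspose_apply, RCLike.star_def, Complex.normSq_conj] at this
        rw [← Finset.sum_mul, this, one_mul]
    _ = ∑ i, ∑ j, Complex.normSq (W i j) * Real.negMulLog (hA.1.eigenvalues j) :=
        Finset.sum_comm
    _ ≤ _ := by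
        refine Finset.sum_le_sum fun i _ => ?_
        rw [hentry]
        have := Real.concaveOn_negMulLog.le_map_sum (t := Finset.univ)
          (w := fun j => Complex.normSq (W i j)) (p := hA.1.eigenvalues)
          (fun j _ => Complex.normSq_nonneg _) (sum_normSq_row hW1 i)
          (fun j _ => hA.eigenvalues_nonneg j)
        simpa only [smul_eq_mul] using this

/-- Entropy is concave, in the form needed here: a mixture of states has at least the least entropy
of its components. -/
lemma le_entropy_sum {ι : Type*} [Fintype ι] {p : ι → ℝ} {A : ι → Matrix n n ℂ} {m : ℝ}
    (hp : ∀ k, 0 ≤ p k) (hp1 : ∑ k, p k = 1) (hA : ∀ k, (A k).PosSemidef)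
    (hm : ∀ k, m ≤ entropy (A k)) : m ≤ entropy (∑ k, (p k : ℂ) • A k) := by
  have hS : (∑ k, (p k : ℂ) • A k).PosSemidef :=
    Matrix.posSemidef_sum _ fun k _ => (hA k).smul (by exact_mod_cast hp k)
  have hlog : 0 < Real.log 2 := Real.log_pos one_lt_two
  rw [entropy_eq_sum_eigenvalues hS.1, le_div_iff₀ hlog]
  set V : Matrix n n ℂ := hS.1.eigenvectorUnitary.val with hV
  have hVV : Vᴴ * V = 1 := Unitary.coe_star_mul_self hS.1.eigenvectorUnitary
  have hdiag := conj_eigenvectorUnitary hS.1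
  rw [← hV] at hdiag
  have hentry : ∀ i, hS.1.eigenvalues i = ∑ k, p k * ((Vᴴ * A k * V) i i).re := by
    intro i
    have h := congrFun (congrFun hdiag i) i
    rw [Matrix.diagonal_apply_eq, Matrix.mul_sum, Matrix.sum_mul, Matrix.sum_apply] at h
    have h2 := congrArg Complex.re h
    rw [Complex.ofReal_re, Complex.re_sum] at h2
    rw [← h2]
    refine Finset.sum_congr rfl fun k _ => ?_
    rw [Matrix.mul_smul, Matrix.smul_mul, Matrix.smul_apply, smul_eq_mul, Complex.re_ofReal_mul]
  have hnn : ∀ k i, 0 ≤ ((Vᴴ * A k * V) i i).re := fun k i =>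
    (Complex.le_def.mp ((hA k).conjTranspose_mul_mul_same V).diag_nonneg).1
  calc m * Real.log 2 = ∑ k, p k * (m * Real.log 2) := by rw [← Finset.sum_mul, hp1, one_mul]
    _ ≤ ∑ k, p k * ∑ i, Real.negMulLog ((Vᴴ * A k * V) i i).re := by
        refine Finset.sum_le_sum fun k _ => mul_le_mul_of_nonneg_left ?_ (hp k)
        refine le_trans ?_ (sum_negMulLog_eigenvalues_le (hA k) hVV)
        have := hm k
        rwa [entropy_eq_sum_eigenvalues (hA k).1, le_div_iff₀ hlog] at this
    _ = ∑ i, ∑ k, p k * Real.negMulLog ((Vᴴ * A k * V) i i).re := by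
        simp only [Finset.mul_sum]
        exact Finset.sum_comm
    _ ≤ _ := by
        refine Finset.sum_le_sum fun i _ => ?_
        rw [hentry]
        have := Real.concaveOn_negMulLog.le_map_sum (t := Finset.univ)
          (w := p) (p := fun k => ((Vᴴ * A k * V) i i).re)
          (fun k _ => hp k) hp1 (fun k _ => hnn k i)
        simpa only [smul_eq_mul] using this

/-- The entropy of a density matrix is at most that of the completely mixed state. -/
lemma entropy_le_logb_card [Nonempty n] {A : Matrix n n ℂ} (hA : IsDensity A) :
    entropy A ≤ Real.logb 2 (Fintype.card n) := by
  have hlog : 0 < Real.log 2 := Real.log_pos one_lt_two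
  have hn : (0 : ℝ) < Fintype.card n := by exact_mod_cast Fintype.card_pos
  have hsum := hA.sum_eigenvalues
  rw [entropy_eq_sum_eigenvalues hA.1.1, Real.logb]
  gcongr
  have := Real.concaveOn_negMulLog.le_map_sum (t := Finset.univ)
    (w := fun _ : n => (Fintype.card n : ℝ)⁻¹) (p := hA.1.1.eigenvalues)
    (fun _ _ => by positivity) (by simp)
    (fun i _ => hA.1.eigenvalues_nonneg i)
  simp only [smul_eq_mul, ← Finset.mul_sum, hsum, mul_one] at this
  rw [Real.negMulLog, Real.log_inv, neg_mul_neg] at this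
  exact le_of_mul_le_mul_left this (by positivity)

/-- Spectrum of `c + p |ψ⟩⟨ψ| + q |φ⟩⟨φ|` for unit vectors `ψ`, `φ`. The rank-two part factors as
`V W` with `V` of size `n × 2`, so that its nonzero spectrum is that of the `2 × 2` matrix `W V`, which
depends on the overlap `⟨φ|ψ⟩` only. -/
lemma charpoly_roots_scalar_add_two_proj {ψ φ : n → ℂ} (hψ : IsUnitVec ψ) (hφ : IsUnitVec φ)
    (hn : 2 ≤ Fintype.card n) {c p q k : ℝ}
    (hk : k ^ 2 = (p + q) ^ 2 / 4 - p * q * (1 - Complex.normSq (star φ ⬝ᵥ ψ))) :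
    ((c : ℂ) • (1 : Matrix n n ℂ) + (p : ℂ) • proj ψ + (q : ℂ) • proj φ).charpoly.roots =
      Multiset.replicate (Fintype.card n - 2) (c : ℂ) +
        {((c + (p + q) / 2 + k : ℝ) : ℂ), ((c + (p + q) / 2 - k : ℝ) : ℂ)} := by
  classical
  open Polynomial in
  set V : Matrix n (Fin 2) ℂ := Matrix.of fun i => ![ψ i, φ i] with hV
  set W : Matrix (Fin 2) n ℂ := Matrix.of ![fun i => p * star (ψ i), fun i => q * star (φ i)] with hW
  have h1 : ((c : ℂ) • (1 : Matrix n n ℂ) + (p : ℂ) • proj ψ + (q : ℂ) • proj φ) =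
      V * W - Matrix.scalar n (-c : ℂ) := by
    ext i j
    simp [hV, hW, Matrix.mul_apply, Fin.sum_univ_two, proj, Matrix.vecMulVec_apply,
      Matrix.diagonal_apply, Matrix.one_apply]
    split_ifs <;> ring
  have hψ' : ∑ x, starRingEnd ℂ (ψ x) * ψ x = 1 := hψ
  have hφ' : ∑ x, starRingEnd ℂ (φ x) * φ x = 1 := hφ
  have hk' : (k : ℂ) ^ 2 = (p + q) ^ 2 / 4 - p * q * (1 - Complex.normSq (star φ ⬝ᵥ ψ)) := by
    exact_mod_cast hk
  have hov : (Complex.normSq (star φ ⬝ᵥ ψ) : ℂ) =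
      (∑ x, star (φ x) * ψ x) * (∑ x, star (ψ x) * φ x) := by
    rw [← Complex.mul_conj]
    congr 1
    simp [dotProduct, mul_comm]
  have hch : (W * V).charpoly =
      (X - C ((p + q) / 2 + k : ℂ)) * (X - C ((p + q) / 2 - k : ℂ)) := by
    have e00 : (W * V) 0 0 = p := by
      simp [Matrix.mul_apply, hV, hW, mul_assoc, ← Finset.mul_sum, hψ']
    have e11 : (W * V) 1 1 = q := by
      simp [Matrix.mul_apply, hV, hW, mul_assoc, ← Finset.mul_sum, hφ']
    have e01 : (W * V) 0 1 = p * ∑ x, star (ψ x) * φ x := by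
      simp [Matrix.mul_apply, hV, hW, mul_assoc, ← Finset.mul_sum]
    have e10 : (W * V) 1 0 = q * ∑ x, star (φ x) * ψ x := by
      simp [Matrix.mul_apply, hV, hW, mul_assoc, ← Finset.mul_sum]
    rw [Matrix.charpoly_fin_two, Matrix.trace_fin_two, Matrix.det_fin_two, e00, e11, e01, e10]
    have hdet : (p * q - p * (∑ x, star (ψ x) * φ x) * (q * ∑ x, star (φ x) * ψ x) : ℂ) =
        ((p + q) / 2 + k) * ((p + q) / 2 - k) := by
      rw [hov] at hk'
      linear_combination hk'
    have htr : (p + q : ℂ) = ((p + q) / 2 + k) + ((p + q) / 2 - k) := by ring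
    rw [hdet, htr]
    simp only [C_add, C_mul, C_sub]
    ring_nf
  have h2 : (V * W - Matrix.scalar n (-c : ℂ)).charpoly =
      (X - C (c : ℂ)) ^ (Fintype.card n - 2) *
        ((X - C ((c + (p + q) / 2 + k : ℝ) : ℂ)) * (X - C ((c + (p + q) / 2 - k : ℝ) : ℂ))) := by
    rw [Matrix.charpoly_sub_scalar, Matrix.charpoly_mul_comm_of_le _ _ (by simpa using hn), hch]
    simp only [mul_comp, pow_comp, sub_comp, add_comp, X_comp, C_comp, Fintype.card_fin, C_neg, C_add, C_sub,
      Complex.ofReal_add, Complex.ofReal_sub, Complex.ofReal_div, Complex.ofReal_ofNat]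
    ring_nf
  rw [h1, h2, roots_mul, roots_pow, roots_X_sub_C, roots_mul, roots_X_sub_C, roots_X_sub_C,
    Multiset.nsmul_singleton]
  · rfl
  · exact mul_ne_zero (X_sub_C_ne_zero _) (X_sub_C_ne_zero _)
  · exact mul_ne_zero (pow_ne_zero _ (X_sub_C_ne_zero _))
      (mul_ne_zero (X_sub_C_ne_zero _) (X_sub_C_ne_zero _))

end Entropy

/-! ### The channel as a combination of the identity and the spin flip -/

/-- The image `(σ₂ ⊗ σ₂) ψ̄` of `ψ` under the (antiunitary) spin flip, up to a global sign:
`ψ̃ (i, j) = (-1) ^ (i + j) * conj (ψ (1 - i, 1 - j))`. -/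
def spinFlip (ψ : Fin 2 × Fin 2 → ℂ) : Fin 2 × Fin 2 → ℂ := fun k =>
  (-1) ^ (k.1.val + k.2.val) * star (ψ (k.1.rev, k.2.rev))

/-- The determinant of `ψ` as a `2 × 2` matrix; `2 * ‖coeffDet ψ‖` is the concurrence of `ψ`. -/
def coeffDet (ψ : Fin 2 × Fin 2 → ℂ) : ℂ := (Matrix.of fun i j => ψ (i, j)).det

/-- The factor `α = a / 2` by which the channel shrinks the Bloch vector of either qubit. -/
noncomputable def blochFactor (x₀ x₁ : ℝ) : ℝ := (x₀ + x₁) / 2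

/-- The factor `β = (a² + μ d²) / 4` by which the channel shrinks the correlations `σ_i ⊗ σ_j`
(`i, j ≠ 0`). -/
noncomputable def corrFactor (μ x₀ x₁ : ℝ) : ℝ := ((x₀ + x₁) ^ 2 + μ * (x₀ - x₁) ^ 2) / 4

lemma tensorMap_depolarizing_apply (x y : ℝ) (ρ : Matrix (Fin 2 × Fin 2) (Fin 2 × Fin 2) ℂ)
    (a b c d : Fin 2) :
    tensorMap (depolarizing x) (depolarizing y) ρ (a, b) (c, d) =
      x * y * ρ (a, b) (c, d) + x * ((1 - y) / 2) * (if b = d then ∑ j, ρ (a, j) (c, j) else 0) +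
      ((1 - x) / 2) * y * (if a = c then ∑ i, ρ (i, b) (i, d) else 0) +
      ((1 - x) / 2) * ((1 - y) / 2) * (if a = c ∧ b = d then ∑ i, ∑ j, ρ (i, j) (i, j) else 0) := by
  simp only [tensorMap, depolarizing, LinearMap.smulRight_apply, Matrix.smul_apply,
    Matrix.kroneckerMap_apply, Matrix.entryLinearMap_apply, smul_eq_mul, LinearMap.add_apply,
    LinearMap.smul_apply, LinearMap.id_apply, Matrix.traceLinearMap_apply, Matrix.add_apply,
    Fin.sum_univ_two]
  fin_cases a <;> fin_cases b <;> fin_cases c <;> fin_cases d <;> simp <;> ring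

lemma star_spinFlip_dotProduct (ψ : Fin 2 × Fin 2 → ℂ) :
    star (spinFlip ψ) ⬝ᵥ ψ = 2 * coeffDet ψ := by
  simp [dotProduct, Fintype.sum_prod_type, Fin.sum_univ_two, spinFlip, coeffDet,
    Matrix.det_fin_two]
  ring

lemma isUnitVec_spinFlip {ψ : Fin 2 × Fin 2 → ℂ} (h : IsUnitVec ψ) : IsUnitVec (spinFlip ψ) := by
  refine Eq.trans ?_ h
  simp [dotProduct, Fintype.sum_prod_type, Fin.sum_univ_two, spinFlip]
  ring

/-- On pure states the channel adds white noise to a combination of the state and its spin flip. -/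
lemma channel_proj (μ x₀ x₁ : ℝ) {ψ : Fin 2 × Fin 2 → ℂ} (h : IsUnitVec ψ) :
    channel μ x₀ x₁ (proj ψ) =
      (((1 - corrFactor μ x₀ x₁) / 4 : ℝ) : ℂ) • (1 : Matrix (Fin 2 × Fin 2) (Fin 2 × Fin 2) ℂ) +
      (((corrFactor μ x₀ x₁ + blochFactor x₀ x₁) / 2 : ℝ) : ℂ) • proj ψ +
      (((corrFactor μ x₀ x₁ - blochFactor x₀ x₁) / 2 : ℝ) : ℂ) • proj (spinFlip ψ) := by
  have h' : starRingEnd ℂ (ψ (0, 0)) * ψ (0, 0) + starRingEnd ℂ (ψ (0, 1)) * ψ (0, 1) +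
      (starRingEnd ℂ (ψ (1, 0)) * ψ (1, 0) + starRingEnd ℂ (ψ (1, 1)) * ψ (1, 1)) = 1 := by
    simpa [IsUnitVec, dotProduct, Fintype.sum_prod_type, Fin.sum_univ_two] using h
  ext ⟨a, b⟩ ⟨c, d⟩
  simp only [channel, memoryChannel, Fin.sum_univ_two, LinearMap.add_apply, LinearMap.smul_apply,
    Matrix.add_apply, Matrix.smul_apply, tensorMap_depolarizing_apply, smul_eq_mul, proj,
    Matrix.vecMulVec_apply, Pi.star_apply, stationary, transition, corrFactor, blochFactor]
  fin_cases a <;> fin_cases b <;> fin_cases c <;> fin_cases d <;>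
    simp [spinFlip] <;>
    first
    | ring1
    | linear_combination (1 - ((x₀ + x₁) ^ 2 + μ * (x₀ - x₁) ^ 2) / 4 : ℂ) / 4 * h'

/-! ### Output entropy of pure states -/

/-- Entropy of the spectrum `(1 - β) / 4` (twice), `(1 + β) / 4 ± k`, which is the form of the
spectrum of the image of a pure state. -/
noncomputable def outputEntropy (β k : ℝ) : ℝ :=
  (2 * Real.negMulLog ((1 - β) / 4) + Real.negMulLog ((1 + β) / 4 + k) +
    Real.negMulLog ((1 + β) / 4 - k)) / Real.log 2

lemma outputEntropy_anti {β k l : ℝ} (hk : 0 ≤ k) (hkl : k ≤ l) (hl : l ≤ (1 + β) / 4) :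
    outputEntropy β l ≤ outputEntropy β k := by
  have hlog : 0 < Real.log 2 := Real.log_pos one_lt_two
  rcases hk.trans hkl |>.eq_or_lt with h0 | h0
  · rw [show k = l by linarith]
  set u := (1 + β) / 4 with hu
  have hc := Real.concaveOn_negMulLog.2 (x := u + l) (y := u - l)
    (Set.mem_Ici.mpr (by linarith)) (Set.mem_Ici.mpr (by linarith))
  -- Both `u ± k` are convex combinations of `u + l` and `u - l`, with exchanged weights
  have ht : (l + k) / (2 * l) + (l - k) / (2 * l) = 1 := by field_simp; ring
  have h1 : 0 ≤ (l + k) / (2 * l) := by positivity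
  have h2 : 0 ≤ (l - k) / (2 * l) := div_nonneg (by linarith) (by linarith)
  have e1 := hc h1 h2 ht
  have e2 := hc h2 h1 (by rw [add_comm]; exact ht)
  simp only [smul_eq_mul] at e1 e2
  rw [show (l + k) / (2 * l) * (u + l) + (l - k) / (2 * l) * (u - l) = u + k by
    field_simp; ring] at e1
  rw [show (l - k) / (2 * l) * (u + l) + (l + k) / (2 * l) * (u - l) = u - k by
    field_simp; ring] at e2
  unfold outputEntropy
  rw [← hu]
  gcongr ?_ / _
  have e3 : ((l + k) / (2 * l) + (l - k) / (2 * l)) *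
      (Real.negMulLog (u + l) + Real.negMulLog (u - l)) ≤
      Real.negMulLog (u + k) + Real.negMulLog (u - k) := by linarith
  rw [ht, one_mul] at e3
  linarith

lemma charpoly_roots_channel_proj (μ x₀ x₁ : ℝ) {ψ : Fin 2 × Fin 2 → ℂ} (h : IsUnitVec ψ) {k : ℝ}
    (hk : (2 * k) ^ 2 = blochFactor x₀ x₁ ^ 2 * (1 - Complex.normSq (2 * coeffDet ψ)) +
      corrFactor μ x₀ x₁ ^ 2 * Complex.normSq (2 * coeffDet ψ)) :
    (channel μ x₀ x₁ (proj ψ)).charpoly.roots =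
      Multiset.replicate 2 (((1 - corrFactor μ x₀ x₁) / 4 : ℝ) : ℂ) +
        {(((1 + corrFactor μ x₀ x₁) / 4 + k : ℝ) : ℂ),
          (((1 + corrFactor μ x₀ x₁) / 4 - k : ℝ) : ℂ)} := by
  rw [channel_proj μ x₀ x₁ h, charpoly_roots_scalar_add_two_proj (k := k) h (isUnitVec_spinFlip h)
    (by simp) (by rw [star_spinFlip_dotProduct]; linear_combination hk / 4)]
  congr 3
  · ring
  · congr 2; ring

lemma isHermitian_channel_proj (μ x₀ x₁ : ℝ) {ψ : Fin 2 × Fin 2 → ℂ} (h : IsUnitVec ψ) :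
    (channel μ x₀ x₁ (proj ψ)).IsHermitian := by
  rw [channel_proj μ x₀ x₁ h]
  have hs : ∀ (r : ℝ) {A : Matrix (Fin 2 × Fin 2) (Fin 2 × Fin 2) ℂ},
      A.IsHermitian → ((r : ℂ) • A).IsHermitian := by
    intro r A hA
    rw [Matrix.IsHermitian, Matrix.conjTranspose_smul, hA.eq]
    simp
  exact ((hs _ Matrix.isHermitian_one).add (hs _ (isHermitian_proj _))).add
    (hs _ (isHermitian_proj _))

lemma entropy_channel_proj (μ x₀ x₁ : ℝ) {ψ : Fin 2 × Fin 2 → ℂ} (h : IsUnitVec ψ) {k : ℝ}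
    (hk : (2 * k) ^ 2 = blochFactor x₀ x₁ ^ 2 * (1 - Complex.normSq (2 * coeffDet ψ)) +
      corrFactor μ x₀ x₁ ^ 2 * Complex.normSq (2 * coeffDet ψ)) :
    entropy (channel μ x₀ x₁ (proj ψ)) = outputEntropy (corrFactor μ x₀ x₁) k := by
  rw [entropy_eq_roots (isHermitian_channel_proj μ x₀ x₁ h),
    charpoly_roots_channel_proj μ x₀ x₁ h hk, outputEntropy]
  simp only [Multiset.map_add, Multiset.map_replicate, Multiset.insert_eq_cons, Multiset.map_cons,
    Multiset.map_singleton, Multiset.sum_add, Multiset.sum_replicate, Multiset.sum_cons,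
    Multiset.sum_singleton, Complex.ofReal_re, nsmul_eq_mul, Nat.cast_ofNat, add_assoc]

lemma normSq_two_mul_coeffDet_le {ψ : Fin 2 × Fin 2 → ℂ} (h : IsUnitVec ψ) :
    Complex.normSq (2 * coeffDet ψ) ≤ 1 := by
  have h' : ‖ψ (0, 0)‖ ^ 2 + ‖ψ (0, 1)‖ ^ 2 + (‖ψ (1, 0)‖ ^ 2 + ‖ψ (1, 1)‖ ^ 2) = 1 := by
    have : starRingEnd ℂ (ψ (0, 0)) * ψ (0, 0) + starRingEnd ℂ (ψ (0, 1)) * ψ (0, 1) +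
        (starRingEnd ℂ (ψ (1, 0)) * ψ (1, 0) + starRingEnd ℂ (ψ (1, 1)) * ψ (1, 1)) = 1 := by
      simpa [IsUnitVec, dotProduct, Fintype.sum_prod_type, Fin.sum_univ_two] using h
    simp only [Complex.conj_mul'] at this
    exact_mod_cast this
  have hd : ‖2 * coeffDet ψ‖ ≤ 1 := by
    rw [coeffDet, Matrix.det_fin_two, norm_mul]
    simp only [Matrix.of_apply, Complex.norm_ofNat]
    have := norm_sub_le (ψ (0, 0) * ψ (1, 1)) (ψ (0, 1) * ψ (1, 0))
    rw [norm_mul, norm_mul] at this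
    nlinarith [sq_nonneg (‖ψ (0, 0)‖ - ‖ψ (1, 1)‖), sq_nonneg (‖ψ (0, 1)‖ - ‖ψ (1, 0)‖)]
  rw [Complex.normSq_eq_norm_sq]
  exact pow_le_one₀ (norm_nonneg _) hd

/-- Images of pure states are density matrices, and their entropy is at least that of the extreme
spectrum, since `(2 k)²` interpolates between `α²` and `β²`. -/
lemma channel_proj_spec {μ x₀ x₁ K : ℝ} (hα : |blochFactor x₀ x₁| ≤ K)
    (hβ : |corrFactor μ x₀ x₁| ≤ K) (hK : K ≤ (1 + corrFactor μ x₀ x₁) / 2)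
    (hβ1 : corrFactor μ x₀ x₁ ≤ 1) {ψ : Fin 2 × Fin 2 → ℂ} (h : IsUnitVec ψ) :
    IsDensity (channel μ x₀ x₁ (proj ψ)) ∧
      outputEntropy (corrFactor μ x₀ x₁) (K / 2) ≤ entropy (channel μ x₀ x₁ (proj ψ)) := by
  set α := blochFactor x₀ x₁ with hαd
  set β := corrFactor μ x₀ x₁ with hβd
  set t := Complex.normSq (2 * coeffDet ψ) with htd
  have ht0 : 0 ≤ t := Complex.normSq_nonneg _
  have ht1 : t ≤ 1 := normSq_two_mul_coeffDet_le h
  have hK0 : 0 ≤ K := (abs_nonneg _).trans hα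
  have hα2 : α ^ 2 ≤ K ^ 2 := sq_le_sq' (abs_le.mp hα).1 (abs_le.mp hα).2
  have hβ2 : β ^ 2 ≤ K ^ 2 := sq_le_sq' (abs_le.mp hβ).1 (abs_le.mp hβ).2
  set s := α ^ 2 * (1 - t) + β ^ 2 * t with hs
  have hs0 : 0 ≤ s :=
    add_nonneg (mul_nonneg (sq_nonneg _) (by linarith)) (mul_nonneg (sq_nonneg _) ht0)
  have hsK : s ≤ K ^ 2 := by nlinarith
  have hk : (2 * (Real.sqrt s / 2)) ^ 2 = s := by
    rw [mul_div_cancel₀ _ two_ne_zero, Real.sq_sqrt hs0]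
  have hkK : Real.sqrt s ≤ K := Real.sqrt_le_iff.mpr ⟨hK0, hsK⟩
  have hk0 : 0 ≤ Real.sqrt s := Real.sqrt_nonneg s
  refine ⟨⟨posSemidef_of_roots (isHermitian_channel_proj μ x₀ x₁ h) ?_, ?_⟩, ?_⟩
  · intro z hz
    rw [charpoly_roots_channel_proj μ x₀ x₁ h hk, Multiset.mem_add] at hz
    simp only [Multiset.mem_replicate, Multiset.insert_eq_cons, Multiset.mem_cons,
      Multiset.mem_singleton] at hz
    rcases hz with ⟨-, rfl⟩ | rfl | rfl <;> rw [Complex.ofReal_re] <;> linarith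
  · have hp : ∀ {φ : Fin 2 × Fin 2 → ℂ}, IsUnitVec φ → (proj φ).trace = 1 := fun hφ =>
      hφ.isDensity_proj.2
    rw [channel_proj μ x₀ x₁ h, Matrix.trace_add, Matrix.trace_add, Matrix.trace_smul,
      Matrix.trace_smul, Matrix.trace_smul, hp h, hp (isUnitVec_spinFlip h), Matrix.trace_one]
    simp
    ring
  · rw [entropy_channel_proj μ x₀ x₁ h hk]
    exact outputEntropy_anti (by linarith) (by linarith) (by linarith)

lemma IsDensity.sum {ι : Type*} [Fintype ι] {n : Type} [Fintype n] {p : ι → ℝ}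
    {A : ι → Matrix n n ℂ} (hp : ∀ k, 0 ≤ p k) (hp1 : ∑ k, p k = 1) (hA : ∀ k, IsDensity (A k)) :
    IsDensity (∑ k, (p k : ℂ) • A k) := by
  refine ⟨Matrix.posSemidef_sum _ fun k _ => (hA k).1.smul (by exact_mod_cast hp k), ?_⟩
  rw [Matrix.trace_sum]
  simp only [Matrix.trace_smul, (hA _).2, smul_eq_mul, mul_one]
  exact_mod_cast hp1

/-- The bounds of `channel_proj_spec` extend to mixed inputs by linearity of the channel and concavity
of the entropy. -/
lemma channel_spec {μ x₀ x₁ K : ℝ} (hα : |blochFactor x₀ x₁| ≤ K)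
    (hβ : |corrFactor μ x₀ x₁| ≤ K) (hK : K ≤ (1 + corrFactor μ x₀ x₁) / 2)
    (hβ1 : corrFactor μ x₀ x₁ ≤ 1) {ρ : Matrix (Fin 2 × Fin 2) (Fin 2 × Fin 2) ℂ}
    (h : IsDensity ρ) :
    IsDensity (channel μ x₀ x₁ ρ) ∧
      outputEntropy (corrFactor μ x₀ x₁) (K / 2) ≤ entropy (channel μ x₀ x₁ ρ) := by
  obtain ⟨p, ψ, hp, hp1, hψ, rfl⟩ := h.exists_eq_sum_proj
  simp only [map_sum, map_smul]
  have := fun i => channel_proj_spec hα hβ hK hβ1 (hψ i)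
  exact ⟨IsDensity.sum hp hp1 fun i => (this i).1,
    le_entropy_sum hp hp1 (fun i => (this i).1.1) fun i => (this i).2⟩

lemma holevo_le {μ x₀ x₁ K : ℝ} (hα : |blochFactor x₀ x₁| ≤ K)
    (hβ : |corrFactor μ x₀ x₁| ≤ K) (hK : K ≤ (1 + corrFactor μ x₀ x₁) / 2)
    (hβ1 : corrFactor μ x₀ x₁ ≤ 1) (𝓔 : Ensemble (Fin 2 × Fin 2)) :
    holevo (channel μ x₀ x₁) 𝓔 ≤ 2 - outputEntropy (corrFactor μ x₀ x₁) (K / 2) := by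
  have h := fun i => channel_spec hα hβ hK hβ1 (𝓔.isDensity i)
  have h1 := entropy_le_logb_card (IsDensity.sum 𝓔.prob_nonneg 𝓔.prob_sum fun i => (h i).1)
  have hlog : Real.logb 2 (Fintype.card (Fin 2 × Fin 2)) = 2 := by
    rw [Real.logb_eq_iff_rpow_eq] <;> norm_num
  rw [hlog] at h1
  have h2 : outputEntropy (corrFactor μ x₀ x₁) (K / 2) ≤
      ∑ i, 𝓔.prob i * entropy (channel μ x₀ x₁ (𝓔.state i)) := by
    calc _ = ∑ i, 𝓔.prob i * outputEntropy (corrFactor μ x₀ x₁) (K / 2) := by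
          rw [← Finset.sum_mul, 𝓔.prob_sum, one_mul]
      _ ≤ _ := Finset.sum_le_sum fun i _ =>
          mul_le_mul_of_nonneg_left (h i).2 (𝓔.prob_nonneg i)
  exact sub_le_sub h1 h2

/-! ### The Pauli orbit of a pure state -/

/-- The Pauli matrices, suitably normalized, form an orthonormal basis of the `2 × 2` matrices. -/
lemma sum_pauli_mul_star (a b c d : Fin 2) :
    ∑ i, pauli i a b * star (pauli i c d) = if a = c ∧ b = d then 2 else 0 := by
  fin_cases a <;> fin_cases b <;> fin_cases c <;> fin_cases d <;>
    simp [Fin.sum_univ_four, pauli] <;> norm_num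

lemma sum_proj_pauli {ψ : Fin 2 × Fin 2 → ℂ} (h : IsUnitVec ψ) :
    ∑ k : Fin 4 × Fin 4, proj ((pauli k.1 ⊗ₖ pauli k.2) *ᵥ ψ) =
      (4 : ℂ) • (1 : Matrix (Fin 2 × Fin 2) (Fin 2 × Fin 2) ℂ) := by
  ext ⟨a, b⟩ ⟨c, d⟩
  have key : (∑ k : Fin 4 × Fin 4, proj ((pauli k.1 ⊗ₖ pauli k.2) *ᵥ ψ)) (a, b) (c, d) =
      ∑ x : Fin 2 × Fin 2, ∑ y : Fin 2 × Fin 2,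
        (∑ i, pauli i a x.1 * star (pauli i c y.1)) * (∑ j, pauli j b x.2 * star (pauli j d y.2)) *
          (ψ x * star (ψ y)) := by
    simp only [Matrix.sum_apply, proj, Matrix.vecMulVec_apply, Pi.star_apply, Matrix.mulVec,
      dotProduct, Matrix.kroneckerMap_apply, star_sum, star_mul', Finset.sum_mul_sum]
    rw [Finset.sum_comm]
    refine Finset.sum_congr rfl fun x _ => ?_
    rw [Finset.sum_comm]
    refine Finset.sum_congr rfl fun y _ => ?_
    rw [Finset.sum_mul, Fintype.sum_prod_type]
    refine Finset.sum_congr rfl fun i _ => ?_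
    rw [Finset.sum_mul]
    refine Finset.sum_congr rfl fun j _ => ?_
    ring
  have hψ : ∑ x, ψ x * star (ψ x) = 1 := by
    rw [← h, dotProduct_comm]; rfl
  rw [key]
  simp only [sum_pauli_mul_star]
  by_cases hac : a = c <;> by_cases hbd : b = d
  · subst hac hbd
    have : ∀ x : Fin 2 × Fin 2, ∑ y : Fin 2 × Fin 2, (if a = a ∧ x.1 = y.1 then (2 : ℂ) else 0) *
        (if b = b ∧ x.2 = y.2 then 2 else 0) * (ψ x * star (ψ y)) = 4 * (ψ x * star (ψ x)) := by
      intro x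
      rw [Finset.sum_eq_single x]
      · simp only [and_self, if_true]
        ring
      · intro y _ hy
        by_cases h1 : x.1 = y.1
        · by_cases h2 : x.2 = y.2
          · exact absurd (Prod.ext h1 h2).symm hy
          · simp [h2]
        · simp [h1]
      · simp
    rw [Finset.sum_congr rfl fun x _ => this x, ← Finset.mul_sum, hψ]
    simp
  all_goals simp [hac, hbd]

lemma channel_one (μ x₀ x₁ : ℝ) : channel μ x₀ x₁ 1 = 1 := by
  ext ⟨a, b⟩ ⟨c, d⟩
  simp only [channel, memoryChannel, Fin.sum_univ_two, LinearMap.add_apply, LinearMap.smul_apply,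
    Matrix.add_apply, Matrix.smul_apply, tensorMap_depolarizing_apply, smul_eq_mul, stationary,
    transition]
  fin_cases a <;> fin_cases b <;> fin_cases c <;> fin_cases d <;>
    simp <;> ring

lemma entropy_maximallyMixed :
    entropy ((1 / 4 : ℂ) • (1 : Matrix (Fin 2 × Fin 2) (Fin 2 × Fin 2) ℂ)) = 2 := by
  have hd : (1 / 4 : ℂ) • (1 : Matrix (Fin 2 × Fin 2) (Fin 2 × Fin 2) ℂ) =
      Matrix.diagonal fun _ => 1 / 4 := by
    rw [Matrix.smul_one_eq_diagonal]
  have hH : (Matrix.diagonal fun _ : Fin 2 × Fin 2 => (1 / 4 : ℂ)).IsHermitian :=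
    Matrix.isHermitian_diagonal_of_self_adjoint _ (by ext; simp)
  rw [hd, entropy_eq_roots hH, Matrix.charpoly_diagonal]
  have hlog : Real.log 2 ≠ 0 := (Real.log_pos one_lt_two).ne'
  have h4 : Real.log 4 = 2 * Real.log 2 := by
    rw [show (4 : ℝ) = 2 ^ 2 by norm_num, Real.log_pow]; norm_num
  simp only [Finset.prod_const, Finset.card_univ, Fintype.card_prod, Fintype.card_fin,
    Polynomial.roots_pow, Polynomial.roots_X_sub_C, Multiset.nsmul_singleton,
    Multiset.map_replicate, Multiset.sum_replicate]
  have hre : ((1 / 4 : ℂ)).re = 1 / 4 := by norm_num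
  rw [hre, Real.negMulLog, one_div, Real.log_inv, h4]
  rw [nsmul_eq_mul]
  field_simp
  norm_num

lemma coeffDet_kronecker_mulVec (A B : Matrix (Fin 2) (Fin 2) ℂ) (ψ : Fin 2 × Fin 2 → ℂ) :
    coeffDet ((A ⊗ₖ B) *ᵥ ψ) = A.det * B.det * coeffDet ψ := by
  simp [coeffDet, Matrix.det_fin_two, Matrix.mulVec, dotProduct, Fintype.sum_prod_type,
    Fin.sum_univ_two]
  ring

lemma normSq_det_pauli (i : Fin 4) : Complex.normSq (pauli i).det = 1 := by
  fin_cases i <;> simp [pauli, Matrix.det_fin_two]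

lemma holevo_pauliEnsemble (μ x₀ x₁ : ℝ) {ψ : Fin 2 × Fin 2 → ℂ} (h : IsUnitVec ψ) {k : ℝ}
    (hk : (2 * k) ^ 2 = blochFactor x₀ x₁ ^ 2 * (1 - Complex.normSq (2 * coeffDet ψ)) +
      corrFactor μ x₀ x₁ ^ 2 * Complex.normSq (2 * coeffDet ψ)) :
    holevo (channel μ x₀ x₁) (pauliEnsemble ψ h) =
      2 - outputEntropy (corrFactor μ x₀ x₁) k := by
  have h1 : (∑ i, ((pauliEnsemble ψ h).prob i : ℂ) •
      channel μ x₀ x₁ ((pauliEnsemble ψ h).state i)) =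
      (1 / 4 : ℂ) • (1 : Matrix (Fin 2 × Fin 2) (Fin 2 × Fin 2) ℂ) := by
    have : ∀ k : Fin 4 × Fin 4, (((1 / 16 : ℝ)) : ℂ) •
        channel μ x₀ x₁ (proj ((pauli k.1 ⊗ₖ pauli k.2) *ᵥ ψ)) =
        channel μ x₀ x₁ ((((1 / 16 : ℝ)) : ℂ) • proj ((pauli k.1 ⊗ₖ pauli k.2) *ᵥ ψ)) :=
      fun k => (map_smul _ _ _).symm
    change (∑ k : Fin 4 × Fin 4, (((1 / 16 : ℝ)) : ℂ) •
        channel μ x₀ x₁ (proj ((pauli k.1 ⊗ₖ pauli k.2) *ᵥ ψ))) = _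
    rw [Finset.sum_congr rfl fun k _ => this k, ← map_sum, ← Finset.smul_sum, sum_proj_pauli h,
      smul_smul, map_smul, channel_one]
    norm_num
  have h2 : ∀ i : Fin 4 × Fin 4, entropy (channel μ x₀ x₁ (proj ((pauli i.1 ⊗ₖ pauli i.2) *ᵥ ψ))) =
      outputEntropy (corrFactor μ x₀ x₁) k := by
    intro i
    have hc : Complex.normSq (2 * coeffDet ((pauli i.1 ⊗ₖ pauli i.2) *ᵥ ψ)) =
        Complex.normSq (2 * coeffDet ψ) := by
      rw [coeffDet_kronecker_mulVec]
      simp only [map_mul, normSq_det_pauli, one_mul]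
    exact entropy_channel_proj μ x₀ x₁ (h.pauli_mulVec i.1 i.2) (by rw [hc, hk])
  rw [holevo, h1, entropy_maximallyMixed]
  congr 1
  change (∑ i : Fin 4 × Fin 4, (1 / 16 : ℝ) *
    entropy (channel μ x₀ x₁ (proj ((pauli i.1 ⊗ₖ pauli i.2) *ᵥ ψ)))) = _
  simp only [h2, Finset.sum_const, Finset.card_univ, Fintype.card_prod, Fintype.card_fin, nsmul_eq_mul]
  norm_num
  ring

/-- The Pauli orbit of `ψ` is optimal as soon as the image of `ψ` has the extreme spectrum: its average
output is completely mixed, and all its members have the least possible output entropy. -/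
lemma isOptimal_pauliEnsemble {μ x₀ x₁ K : ℝ} (hα : |blochFactor x₀ x₁| ≤ K)
    (hβ : |corrFactor μ x₀ x₁| ≤ K) (hK : K ≤ (1 + corrFactor μ x₀ x₁) / 2)
    (hβ1 : corrFactor μ x₀ x₁ ≤ 1) {ψ : Fin 2 × Fin 2 → ℂ} (h : IsUnitVec ψ)
    (hk : K ^ 2 = blochFactor x₀ x₁ ^ 2 * (1 - Complex.normSq (2 * coeffDet ψ)) +
      corrFactor μ x₀ x₁ ^ 2 * Complex.normSq (2 * coeffDet ψ)) :
    IsOptimal (channel μ x₀ x₁) (pauliEnsemble ψ h) ∧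
      twoUseCapacity μ x₀ x₁ = 1 - outputEntropy (corrFactor μ x₀ x₁) (K / 2) / 2 := by
  have hv := holevo_pauliEnsemble μ x₀ x₁ h (k := K / 2)
    (by rw [mul_div_cancel₀ _ two_ne_zero, hk])
  have ho : IsOptimal (channel μ x₀ x₁) (pauliEnsemble ψ h) := by
    refine ⟨⟨_, rfl⟩, ?_⟩
    rintro _ ⟨𝓔, rfl⟩
    rw [hv]
    exact holevo_le hα hβ hK hβ1 𝓔
  refine ⟨ho, ?_⟩
  rw [twoUseCapacity, holevoCapacity, IsGreatest.csSup_eq ho, hv]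
  ring

/-! ### Product and maximally entangled vectors -/

/-- `ψ` is maximally entangled exactly when `√2` times its coefficient matrix is unitary. The second
condition is stated for the transpose, so that exchanging the qubits exchanges the two conditions. -/
lemma isMaxEntangledVec_iff (ψ : Fin 2 × Fin 2 → ℂ) :
    IsMaxEntangledVec ψ ↔
      (Matrix.of fun i j => ψ (i, j)) * (Matrix.of fun i j => ψ (i, j))ᴴ =
        (1 / 2 : ℂ) • (1 : Matrix (Fin 2) (Fin 2) ℂ) ∧
      (Matrix.of fun i j => ψ (i, j))ᵀ * (Matrix.of fun i j => ψ (i, j))ᵀᴴ =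
        (1 / 2 : ℂ) • (1 : Matrix (Fin 2) (Fin 2) ℂ) := by
  simp only [← Matrix.ext_iff, IsMaxEntangledVec, Matrix.mul_apply, Matrix.conjTranspose_apply,
    Matrix.transpose_apply, Matrix.of_apply, Matrix.smul_apply, Matrix.one_apply, smul_eq_mul,
    mul_ite, mul_one, mul_zero]

lemma of_kronecker_mulVec (A B : Matrix (Fin 2) (Fin 2) ℂ) (ψ : Fin 2 × Fin 2 → ℂ) :
    (Matrix.of fun i j => ((A ⊗ₖ B) *ᵥ ψ) (i, j)) = A * (Matrix.of fun i j => ψ (i, j)) * Bᵀ := by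
  ext i j
  simp [Matrix.mulVec, dotProduct, Matrix.mul_apply, Fintype.sum_prod_type, Fin.sum_univ_two]
  ring

lemma IsMaxEntangledVec.kronecker_mulVec {ψ : Fin 2 × Fin 2 → ℂ} (h : IsMaxEntangledVec ψ)
    {A B : Matrix (Fin 2) (Fin 2) ℂ} (hA : Aᴴ * A = 1) (hB : Bᴴ * B = 1) :
    IsMaxEntangledVec ((A ⊗ₖ B) *ᵥ ψ) := by
  have key : ∀ {A B M : Matrix (Fin 2) (Fin 2) ℂ}, Aᴴ * A = 1 → Bᴴ * B = 1 →
      M * Mᴴ = (1 / 2 : ℂ) • 1 → (A * M * Bᵀ) * (A * M * Bᵀ)ᴴ = (1 / 2 : ℂ) • 1 := by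
    intro A B M hA hB hM
    have hB' : Bᵀ * Bᵀᴴ = 1 := by
      have := congrArg Matrix.transpose hB
      rwa [Matrix.transpose_mul, Matrix.transpose_one] at this
    calc (A * M * Bᵀ) * (A * M * Bᵀ)ᴴ = A * (M * (Bᵀ * Bᵀᴴ) * Mᴴ) * Aᴴ := by
          simp only [Matrix.conjTranspose_mul, Matrix.mul_assoc]
      _ = (1 / 2 : ℂ) • 1 := by
          rw [hB', Matrix.mul_one, hM, Matrix.mul_smul, Matrix.smul_mul, Matrix.mul_one,
            mul_eq_one_comm.mp hA]
  rw [isMaxEntangledVec_iff] at h ⊢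
  rw [of_kronecker_mulVec]
  refine ⟨key hA hB h.1, ?_⟩
  have : (A * (Matrix.of fun i j => ψ (i, j)) * Bᵀ)ᵀ =
      B * (Matrix.of fun i j => ψ (i, j))ᵀ * Aᵀ := by
    simp only [Matrix.transpose_mul, Matrix.transpose_transpose, Matrix.mul_assoc]
  rw [this]
  exact key hB hA h.2

lemma IsMaxEntangledVec.normSq_two_mul_coeffDet {ψ : Fin 2 × Fin 2 → ℂ}
    (h : IsMaxEntangledVec ψ) : Complex.normSq (2 * coeffDet ψ) = 1 := by
  have h1 := congrArg Matrix.det ((isMaxEntangledVec_iff ψ).mp h).1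
  rw [Matrix.det_mul, Matrix.det_conjTranspose, Matrix.det_smul, Matrix.det_one] at h1
  have h2 : (Complex.normSq (coeffDet ψ) : ℂ) = 1 / 4 := by
    rw [← Complex.mul_conj]
    refine h1.trans ?_
    norm_num
  have h3 : Complex.normSq (coeffDet ψ) = 1 / 4 := by
    apply Complex.ofReal_injective
    rw [h2]; norm_num
  rw [map_mul, h3]
  norm_num

lemma IsProductVec.coeffDet_eq_zero {ψ : Fin 2 × Fin 2 → ℂ} (h : IsProductVec ψ) :
    coeffDet ψ = 0 := by
  obtain ⟨u, v, -, -, h⟩ := h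
  simp only [coeffDet, Matrix.det_fin_two, Matrix.of_apply, h]
  ring

lemma IsUnitVec.mulVec {n : Type} [Fintype n] [DecidableEq n] {u : n → ℂ} (hu : IsUnitVec u)
    {A : Matrix n n ℂ} (hA : Aᴴ * A = 1) : IsUnitVec (A *ᵥ u) := by
  unfold IsUnitVec at *
  rw [Matrix.star_mulVec, Matrix.dotProduct_mulVec, Matrix.vecMul_vecMul, hA, Matrix.vecMul_one, hu]

lemma IsProductVec.kronecker_mulVec {ψ : Fin 2 × Fin 2 → ℂ} (h : IsProductVec ψ)
    {A B : Matrix (Fin 2) (Fin 2) ℂ} (hA : Aᴴ * A = 1) (hB : Bᴴ * B = 1) :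
    IsProductVec ((A ⊗ₖ B) *ᵥ ψ) := by
  obtain ⟨u, v, hu, hv, h⟩ := h
  refine ⟨A *ᵥ u, B *ᵥ v, hu.mulVec hA, hv.mulVec hB, fun i j => ?_⟩
  simp [Matrix.mulVec, dotProduct, Fintype.sum_prod_type, Fin.sum_univ_two, h]
  ring

lemma exists_isProductVec : ∃ ψ : Fin 2 × Fin 2 → ℂ, IsUnitVec ψ ∧ IsProductVec ψ := by
  refine ⟨fun k => if k = (0, 0) then 1 else 0, ?_, ![1, 0], ![1, 0], ?_, ?_, ?_⟩
  · simp [IsUnitVec, dotProduct]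
  · simp [IsUnitVec, dotProduct]
  · simp [IsUnitVec, dotProduct]
  · intro i j
    fin_cases i <;> fin_cases j <;> simp

/-- The Bell vector `(|00⟩ + |11⟩) / √2`. -/
lemma exists_isMaxEntangledVec : ∃ ψ : Fin 2 × Fin 2 → ℂ, IsUnitVec ψ ∧ IsMaxEntangledVec ψ := by
  have h : ((Real.sqrt 2 : ℝ) : ℂ)⁻¹ * ((Real.sqrt 2 : ℝ) : ℂ)⁻¹ = 1 / 2 := by
    rw [← mul_inv, ← Complex.ofReal_mul, Real.mul_self_sqrt (by norm_num)]
    norm_num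
  refine ⟨fun k => if k.1 = k.2 then ((Real.sqrt 2 : ℝ) : ℂ)⁻¹ else 0, ?_, ?_, ?_⟩
  · simp [IsUnitVec, dotProduct, Fintype.sum_prod_type, h]
  · intro i j
    fin_cases i <;> fin_cases j <;> simp [h]
  · intro i j
    fin_cases i <;> fin_cases j <;> simp [h]

/-! ### The eigenvalues in the capacity formulas -/

lemma eig01_eq (μ x₀ x₁ : ℝ) : eig01 μ x₀ x₁ = (1 - corrFactor μ x₀ x₁) / 4 := by
  unfold eig01 corrFactor; ring

lemma eig00_eq (μ x₀ x₁ : ℝ) :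
    eig00 μ x₀ x₁ = (1 + corrFactor μ x₀ x₁) / 4 + blochFactor x₀ x₁ / 2 := by
  unfold eig00 corrFactor blochFactor; ring

lemma eig11_eq (μ x₀ x₁ : ℝ) :
    eig11 μ x₀ x₁ = (1 + corrFactor μ x₀ x₁) / 4 - blochFactor x₀ x₁ / 2 := by
  unfold eig11 corrFactor blochFactor; ring

lemma outputEntropy_abs (β k : ℝ) : outputEntropy β |k| = outputEntropy β k := by
  rcases abs_choice k with h | h <;> rw [h]
  unfold outputEntropy
  rw [← sub_eq_add_neg, sub_neg_eq_add]
  ring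

/-- Case `K = |α|`, the extreme spectrum when product inputs are optimal. -/
lemma outputEntropy_product (μ x₀ x₁ : ℝ) :
    outputEntropy (corrFactor μ x₀ x₁) (|blochFactor x₀ x₁| / 2) =
      -(eig00 μ x₀ x₁ * Real.logb 2 (eig00 μ x₀ x₁) +
          2 * eig01 μ x₀ x₁ * Real.logb 2 (eig01 μ x₀ x₁) +
          eig11 μ x₀ x₁ * Real.logb 2 (eig11 μ x₀ x₁)) := by
  rw [← abs_two, ← abs_div, outputEntropy_abs, abs_two, eig00_eq, eig01_eq, eig11_eq]
  simp only [outputEntropy, Real.negMulLog, Real.logb]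
  ring

/-- Case `K = |β|`, the extreme spectrum when maximally entangled inputs are optimal. For either sign
of `β` it consists of `(1 + 3 β) / 4` and three times `(1 - β) / 4`. -/
lemma outputEntropy_maxEntangled (μ x₀ x₁ : ℝ) :
    outputEntropy (corrFactor μ x₀ x₁) (|corrFactor μ x₀ x₁| / 2) =
      -((1 - 3 * eig01 μ x₀ x₁) * Real.logb 2 (1 - 3 * eig01 μ x₀ x₁) +
          3 * eig01 μ x₀ x₁ * Real.logb 2 (eig01 μ x₀ x₁)) := by
  rw [← abs_two, ← abs_div, outputEntropy_abs, abs_two, eig01_eq]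
  set β := corrFactor μ x₀ x₁
  have h1 : (1 + β) / 4 + β / 2 = 1 - 3 * ((1 - β) / 4) := by ring
  have h2 : (1 + β) / 4 - β / 2 = (1 - β) / 4 := by ring
  simp only [outputEntropy, h1, h2, Real.negMulLog, Real.logb]
  ring

/-- In the range where `Λ₀` and `Λ₁` are channels, the spectra of the extreme outputs are
nonnegative. -/
lemma factor_bounds {μ x₀ x₁ : ℝ} (hμ : μ ∈ Set.Ioo (-1 : ℝ) 1)
    (hx₀ : x₀ ∈ Set.Icc (-1 / 3 : ℝ) 1) (hx₁ : x₁ ∈ Set.Icc (-1 / 3 : ℝ) 1) :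
    |blochFactor x₀ x₁| ≤ (1 + corrFactor μ x₀ x₁) / 2 ∧
      |corrFactor μ x₀ x₁| ≤ (1 + corrFactor μ x₀ x₁) / 2 ∧ corrFactor μ x₀ x₁ ≤ 1 := by
  obtain ⟨hμ0, hμ1⟩ := hμ
  obtain ⟨h00, h01⟩ := hx₀
  obtain ⟨h10, h11⟩ := hx₁
  have m0 : 0 ≤ (1 + μ) / 4 := by linarith
  have m1 : 0 ≤ (1 - μ) / 4 := by linarith
  have p0 : 0 ≤ 1 + x₀ := by linarith
  have p1 : 0 ≤ 1 + x₁ := by linarith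
  have q0 : 0 ≤ 1 - x₀ := by linarith
  have q1 : 0 ≤ 1 - x₁ := by linarith
  have e00 : 0 ≤ eig00 μ x₀ x₁ := by unfold eig00; positivity
  have e01 : 0 ≤ eig01 μ x₀ x₁ := by unfold eig01; positivity
  have e11 : 0 ≤ eig11 μ x₀ x₁ := by unfold eig11; positivity
  rw [eig00_eq] at e00
  rw [eig01_eq] at e01
  rw [eig11_eq] at e11
  -- The product of two numbers in `[-1/3, 1]` is at least `-1/3`, hence so is `β`.
  have hxx : -1 / 3 ≤ x₀ * x₁ := by nlinarith
  have hβ : -1 / 3 ≤ corrFactor μ x₀ x₁ := by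
    have : corrFactor μ x₀ x₁ =
      (1 + μ) / 4 * (x₀ ^ 2 + x₁ ^ 2) + 2 * ((1 - μ) / 4) * (x₀ * x₁) := by
      unfold corrFactor; ring
    rw [this]
    nlinarith [mul_nonneg m0 (add_nonneg (sq_nonneg x₀) (sq_nonneg x₁))]
  refine ⟨abs_le.mpr ⟨by linarith, by linarith⟩, abs_le.mpr ⟨by linarith, by linarith⟩,
    by linarith⟩

lemma threshold_eq (μ x₀ x₁ : ℝ) :
    threshold μ (x₀ + x₁) (x₀ - x₁) = 4 * (|corrFactor μ x₀ x₁| - |blochFactor x₀ x₁|) := by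
  unfold threshold corrFactor blochFactor
  rw [abs_div, abs_div]
  norm_num
  ring

end QMemory

theorem theorem2 (μ x₀ x₁ a d : ℝ) (hμ : μ ∈ Set.Ioo (-1 : ℝ) 1)
    (hx₀ : x₀ ∈ Set.Icc (-1 / 3 : ℝ) 1) (hx₁ : x₁ ∈ Set.Icc (-1 / 3 : ℝ) 1)
    (ha : a = x₀ + x₁) (hd : d = x₀ - x₁) :
    (0 ≤ threshold μ a d →
      (∃ 𝓔 : Ensemble (Fin 2 × Fin 2),
        (∀ i, ∃ ψ, IsUnitVec ψ ∧ IsMaxEntangledVec ψ ∧ 𝓔.state i = proj ψ) ∧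
          IsOptimal (channel μ x₀ x₁) 𝓔) ∧
      (∀ (ψ : Fin 2 × Fin 2 → ℂ) (hψ : IsUnitVec ψ), IsMaxEntangledVec ψ →
        IsOptimal (channel μ x₀ x₁) (pauliEnsemble ψ hψ)) ∧
      twoUseCapacity μ x₀ x₁ = 1 +
        ((1 - 3 * eig01 μ x₀ x₁) * Real.logb 2 (1 - 3 * eig01 μ x₀ x₁) +
          3 * eig01 μ x₀ x₁ * Real.logb 2 (eig01 μ x₀ x₁)) / 2) ∧
    (threshold μ a d ≤ 0 →
      (∃ 𝓔 : Ensemble (Fin 2 × Fin 2),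
        (∀ i, ∃ ψ, IsUnitVec ψ ∧ IsProductVec ψ ∧ 𝓔.state i = proj ψ) ∧
          IsOptimal (channel μ x₀ x₁) 𝓔) ∧
      (∀ (ψ : Fin 2 × Fin 2 → ℂ) (hψ : IsUnitVec ψ), IsProductVec ψ →
        IsOptimal (channel μ x₀ x₁) (pauliEnsemble ψ hψ)) ∧
      twoUseCapacity μ x₀ x₁ = 1 +
        (eig00 μ x₀ x₁ * Real.logb 2 (eig00 μ x₀ x₁) +
          2 * eig01 μ x₀ x₁ * Real.logb 2 (eig01 μ x₀ x₁) +
          eig11 μ x₀ x₁ * Real.logb 2 (eig11 μ x₀ x₁)) / 2) := by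

  subst ha hd
  obtain ⟨hα, hβ, hβ1⟩ := factor_bounds hμ hx₀ hx₁
  rw [threshold_eq]
  refine ⟨fun hf => ?_, fun hf => ?_⟩
  · have key := fun (ψ : Fin 2 × Fin 2 → ℂ) (hψ : IsUnitVec ψ) (hm : IsMaxEntangledVec ψ) =>
      isOptimal_pauliEnsemble (μ := μ) (x₀ := x₀) (x₁ := x₁) (by linarith) le_rfl hβ hβ1 hψ
        (by rw [hm.normSq_two_mul_coeffDet, sq_abs]; ring)
    obtain ⟨ψ, hψ, hm⟩ := exists_isMaxEntangledVec
    refine ⟨⟨pauliEnsemble ψ hψ, fun k => ⟨_, hψ.pauli_mulVec k.1 k.2, hm.kronecker_mulVec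
      (pauli_conjTranspose_mul _) (pauli_conjTranspose_mul _), rfl⟩, (key ψ hψ hm).1⟩,
      fun ψ hψ hm => (key ψ hψ hm).1, ?_⟩
    rw [(key ψ hψ hm).2, outputEntropy_maxEntangled]
    ring
  · have key := fun (ψ : Fin 2 × Fin 2 → ℂ) (hψ : IsUnitVec ψ) (hp : IsProductVec ψ) =>
      isOptimal_pauliEnsemble (μ := μ) (x₀ := x₀) (x₁ := x₁) le_rfl (by linarith) hα hβ1 hψ
        (by rw [hp.coeffDet_eq_zero, sq_abs]; simp)
    obtain ⟨ψ, hψ, hp⟩ := exists_isProductVec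
    refine ⟨⟨pauliEnsemble ψ hψ, fun k => ⟨_, hψ.pauli_mulVec k.1 k.2, hp.kronecker_mulVec
      (pauli_conjTranspose_mul _) (pauli_conjTranspose_mul _), rfl⟩, (key ψ hψ hp).1⟩,
      fun ψ hψ hp => (key ψ hψ hp).1, ?_⟩
    rw [(key ψ hψ hp).2, outputEntropy_product]
    ring
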